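/- Let $\mathcal{A}$ be a (complex) C*-algebra that has no unit and is not commutative, and let $x\in\mathcal{A}$. Then the following statements are equivalent: 1. $x$ is approximately right invertible, i.e. there is a net $(r_j)_{j\in J}$ in $\mathcal{A}$ such that $(xr_j)_{j\in J}$ is an approximate identity: $\lim_{j} xr_jz=\lim_j z\,xr_j=z$ for every $z\in\mathcal{A}$. 2. $x$ does not belong to any maximal modular right ideal of $\mathcal{A}$. (A right ideal $I$, by definition a linear subspace with $I\mathcal{A}\subseteq I$, is modular if there is $v\in\mathcal{A}$ with $va-a\in I$ for all $a\in\mathcal{A}$; a maximal modular right ideal is a maximal element, with respect to inclusion, of the set of proper modular right ideals.) 3. $\tau(xx^{*})\neq 0$ for every pure state $\tau$ of $\mathcal{A}$. (A state is a positive linear functional of norm $1$; a state $\tau$ is pure if every positive linear functional $\rho$ on $\mathcal{A}$ with $\rho\le\tau$, i.e. $\rho(a)\le\tau(a)$ for all $a\geq 0$, is of the form $\rho=t\tau$ with $t\in[0,1]$.) -/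

import Mathlib

open Filter Topology
open scoped ComplexOrder

universe u

/-- A net `e` (indexed by a type `J` that is meant to be directed) is an approximate identity of
`A` if `e j * a → a` and `a * e j → a` for every `a`. -/
def IsApproximateIdentity {A : Type*} [NonUnitalNormedRing A] {J : Type*} [Preorder J]
    (e : J → A) : Prop :=
  ∀ a : A, Tendsto (fun j => e j * a) atTop (𝓝 a) ∧ Tendsto (fun j => a * e j) atTop (𝓝 a)

/-- `x` is approximately right invertible if `(x * r j)` is an approximate identity for some
net `r` over a nonempty directed index set. -/
def IsApproxRightInvertible {A : Type u} [NonUnitalNormedRing A] (x : A) : Prop :=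
  ∃ (J : Type u) (_ : Preorder J) (_ : IsDirectedOrder J) (_ : Nonempty J) (r : J → A),
    IsApproximateIdentity (fun j => x * r j)

/-- A complex linear subspace `I` is a modular right ideal if it is closed under right
multiplication by elements of `A` and some `v : A` satisfies `v * a - a ∈ I` for all `a`. -/
def IsModularRightIdeal {A : Type*} [NonUnitalCStarAlgebra A] (I : Submodule ℂ A) : Prop :=
  (∀ a ∈ I, ∀ b : A, a * b ∈ I) ∧ ∃ v : A, ∀ a : A, v * a - a ∈ I

/-- A maximal modular right ideal: maximal (for inclusion) among the proper modular right
ideals. -/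
def IsMaximalModularRightIdeal {A : Type*} [NonUnitalCStarAlgebra A] (I : Submodule ℂ A) :
    Prop :=
  Maximal (fun K : Submodule ℂ A => IsModularRightIdeal K ∧ K ≠ ⊤) I

/-- A state: a positive linear functional of operator norm one. Positive functionals on a
C⋆-algebra are bounded, so `τ` is a continuous linear functional. -/
def IsState {A : Type*} [NonUnitalCStarAlgebra A] [PartialOrder A] [StarOrderedRing A]
    (τ : A →ₚ[ℂ] ℂ) : Prop :=
  ‖(⟨τ.toLinearMap, map_continuous τ⟩ : A →L[ℂ] ℂ)‖ = 1

/-- A pure state: a state `τ` such that every positive linear functional `ρ` with `ρ ≤ τ`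
is of the form `t • τ` with `0 ≤ t ≤ 1`. -/
def IsPureState {A : Type*} [NonUnitalCStarAlgebra A] [PartialOrder A] [StarOrderedRing A]
    (τ : A →ₚ[ℂ] ℂ) : Prop :=
  IsState τ ∧ ∀ ρ : A →ₚ[ℂ] ℂ, (∀ a : A, 0 ≤ a → ρ a ≤ τ a) →
    ∃ t ∈ Set.Icc (0 : ℝ) 1, ∀ a : A, ρ a = (t : ℂ) * τ a

/-! The implications run 1 → 2 → 3 → 1.

1 → 2: if `x` lies in a modular right ideal with modular unit `v`, so does `y = x * r j * v`. Once
`‖v - y‖ < 1`, every element has the form `c - (v - y) * c = y * c - (v * c - c)`, so the ideal is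
everything.

2 → 3: a pure state `f` with `f (x * star x) = 0` puts `x` in its right kernel. This right ideal is
proper, and it is modular because `toGNS` is onto (`IsPureState.surjective_toGNS`): a preimage of
the cyclic vector gives the modular unit. For surjectivity, suppose that `b ↦ ⟪η, b ξ⟫`, with `‖η‖ =
1`, has norm at most `δ`. A positive `σ` of norm at most `δ ^ 2` dominates it; the parallel sum `ρ`
of `f` and `σ` is `t • f` by purity, so `t ≤ δ ^ 2`, while `ρ` still dominates up to a factor `2`,
so `1 ≤ 2 * t`. Hence the adjoint of `toGNS` is bounded below.

3 → 1: put `h = x * star x`. By Krein–Milman, if no pure state vanishes at `h`, no nonzero positive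
functional does. Then the elements `h² (h² + δ²)⁻¹`, which have the form `x * r`, form an
approximate identity as `δ → 0`. -/

open scoped InnerProductSpace

/-! ### Domination by positive functionals, and the GNS space without a unit. -/

section PositiveFunctionals

variable {A : Type*} [NonUnitalCStarAlgebra A] [PartialOrder A] [StarOrderedRing A]

/-- A continuous functional whose real part is nonnegative on positive elements agrees, up to its
imaginary part on self-adjoint elements, with a positive functional. -/
theorem exists_positiveLinearMap_eq_re (F : A →L[ℂ] ℂ) (hF : ∀ a, 0 ≤ a → 0 ≤ (F a).re) :
    ∃ ρ : A →ₚ[ℂ] ℂ, ∀ a, IsSelfAdjoint a → ρ a = ((F a).re : ℂ) := by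
  let G : A →ₗ[ℂ] ℂ :=
    { toFun := fun a => (F a + star (F (star a))) / 2
      map_add' := fun a b => by simp only [map_add, star_add]; ring
      map_smul' := fun c a => by
        simp only [map_smul, star_smul, smul_eq_mul, star_mul', star_star, RingHom.id_apply]; ring }
  have hG : ∀ a, IsSelfAdjoint a → G a = ((F a).re : ℂ) := fun a ha => by
    change (F a + star (F (star a))) / 2 = _
    rw [ha.star_eq]
    apply Complex.ext <;> simp
  refine ⟨PositiveLinearMap.mk₀ G fun a ha => ?_, hG⟩
  rw [hG a (.of_nonneg ha)]
  exact_mod_cast hF a ha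

/-- The gap between the two sides is `s * t` times `star (a - b) * (a - b)`. This gives the
convexity needed for the separation in `exists_positive_dominating`. -/
theorem star_mul_self_convex_le (a b : A) {s t : ℝ} (hs : 0 ≤ s) (ht : 0 ≤ t) (hst : s + t = 1) :
    star (s • a + t • b) * (s • a + t • b) ≤ s • (star a * a) + t • (star b * b) := by
  rw [← sub_nonneg]
  have h : s • (star a * a) + t • (star b * b) - star (s • a + t • b) * (s • a + t • b)
      = (s * t) • (star (a - b) * (a - b)) := by
    obtain rfl : t = 1 - s := by linarith
    simp only [star_add, star_sub, star_smul, star_trivial, add_mul, mul_add, sub_mul, mul_sub,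
      smul_mul_assoc, mul_smul_comm, smul_add, smul_sub, smul_smul]
    module
  rw [h]
  exact smul_nonneg (mul_nonneg hs ht) (star_mul_self_nonneg _)

/-- Every contractive functional `ω` is dominated by a positive functional `σ` of norm at most one,
in the sense that `|ω b|² ≤ σ (b⋆ b)`. -/
theorem exists_positive_dominating (ω : A →L[ℂ] ℂ) (hω : ∀ b, ‖ω b‖ ≤ ‖b‖) :
    ∃ σ : A →ₚ[ℂ] ℂ, (∀ a, 0 ≤ a → (σ a).re ≤ ‖a‖) ∧
      ∀ b, ‖ω b‖ ^ 2 ≤ (σ (star b * b)).re := by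
  by_cases h0 : ∃ b, ω b ≠ 0
  swap
  · push Not at h0
    exact ⟨0, fun a _ => by simp, fun b => by simp [h0]⟩
  -- By homogeneity `σ` only has to be at least `1` on `C`. Contractivity of `ω` keeps `C` off the
  -- open unit ball, and a separating functional, divided by the level `u`, yields `σ`.
  let C : Set A := {p | ∃ b, ω b = 1 ∧ star b * b ≤ p}
  have hCconv : Convex ℝ C := by
    rintro p ⟨a, ha, hap⟩ q ⟨b, hb, hbq⟩ s t hs ht hst
    refine ⟨s • a + t • b, ?_, (star_mul_self_convex_le a b hs ht hst).trans ?_⟩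
    · rw [map_add, ← Complex.coe_smul s, ← Complex.coe_smul t, map_smul, map_smul, ha, hb]
      simp [← Complex.ofReal_add, hst]
    · exact add_le_add (smul_le_smul_of_nonneg_left hap hs) (smul_le_smul_of_nonneg_left hbq ht)
  have hdisj : Disjoint (Metric.ball (0 : A) 1) C := by
    rw [Set.disjoint_left]
    rintro p hp ⟨b, hb, hbp⟩
    have h1 : (1 : ℝ) ≤ ‖b‖ := by simpa [hb] using hω b
    have h2 : ‖star b * b‖ ≤ ‖p‖ :=
      CStarAlgebra.norm_le_norm_of_nonneg_of_le (star_mul_self_nonneg b) hbp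
    rw [CStarRing.norm_star_mul_self] at h2
    rw [mem_ball_zero_iff] at hp
    nlinarith
  obtain ⟨F, u, hFball, hFC⟩ := RCLike.geometric_hahn_banach_open (𝕜 := ℂ)
    (convex_ball (0 : A) 1) Metric.isOpen_ball hCconv hdisj
  simp only [RCLike.re_to_complex] at hFball hFC
  have hu : 0 < u := by simpa using hFball 0 (by simp)
  obtain ⟨b₀, hb₀⟩ := h0
  obtain ⟨p₀, hp₀⟩ : C.Nonempty :=
    ⟨_, (ω b₀)⁻¹ • b₀, by simp [hb₀], le_rfl⟩
  -- `C` is upward closed: if `F a` had negative real part, `p₀ + n • a` would stay in `C` and cross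
  -- the hyperplane.
  have hFpos : ∀ a, 0 ≤ a → 0 ≤ (F a).re := fun a ha => by
    by_contra! hneg
    obtain ⟨n, hn⟩ := exists_nat_gt (((F p₀).re - u) / (-(F a).re))
    have hmem : p₀ + (n : ℝ) • a ∈ C := by
      obtain ⟨b, hb, hbp⟩ := hp₀
      exact ⟨b, hb, hbp.trans (le_add_of_nonneg_right (smul_nonneg (by positivity) ha))⟩
    have := hFC _ hmem
    rw [map_add, ← Complex.coe_smul, map_smul] at this
    simp only [Complex.add_re, smul_eq_mul, Complex.re_ofReal_mul] at this
    rw [div_lt_iff₀ (by linarith)] at hn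
    linarith
  have hFnorm : ∀ a, (F a).re ≤ u * ‖a‖ := fun a => by
    refine le_of_forall_pos_le_add fun ε hε => ?_
    set r := ‖a‖ + ε / u with hr
    have hr0 : 0 < r := by positivity
    have := hFball ((r⁻¹ : ℝ) • a) (by
      rw [mem_ball_zero_iff, norm_smul, norm_inv, Real.norm_of_nonneg hr0.le, inv_mul_lt_one₀ hr0]
      have : 0 < ε / u := by positivity
      linarith)
    rw [← Complex.coe_smul, map_smul, smul_eq_mul, Complex.re_ofReal_mul, inv_mul_lt_iff₀ hr0,
      hr, add_mul, div_mul_cancel₀ _ hu.ne'] at this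
    linarith
  obtain ⟨σ, hσ⟩ := exists_positiveLinearMap_eq_re (((u⁻¹ : ℝ) : ℂ) • F) (fun a ha => by
    simpa using mul_nonneg (inv_nonneg.2 hu.le) (hFpos a ha))
  have hσ' : ∀ a, IsSelfAdjoint a → (σ a).re = u⁻¹ * (F a).re := fun a ha => by
    rw [hσ a ha]
    simp
  refine ⟨σ, fun a ha => ?_, fun b => ?_⟩
  · rw [hσ' a (.of_nonneg ha), inv_mul_le_iff₀ hu]
    exact hFnorm a
  · by_cases hb : ω b = 0
    · simpa [hb] using (Complex.nonneg_iff.1 (σ.map_nonneg (star_mul_self_nonneg b))).1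
    · have h1 := hFC (star ((ω b)⁻¹ • b) * ((ω b)⁻¹ • b)) ⟨_, by simp [hb], le_rfl⟩
      have h2 : star ((ω b)⁻¹ • b) * ((ω b)⁻¹ • b)
          = (((‖ω b‖ ^ 2)⁻¹ : ℝ) : ℂ) • (star b * b) := by
        rw [star_smul, smul_mul_smul_comm]
        congr 1
        rw [Complex.star_def, map_inv₀, ← mul_inv, mul_comm, Complex.mul_conj,
          Complex.normSq_eq_norm_sq]
        push_cast; rfl
      rw [h2, map_smul, smul_eq_mul, Complex.re_ofReal_mul, le_inv_mul_iff₀ (by positivity)] at h1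
      rw [hσ' _ (.star_mul_self b), le_inv_mul_iff₀ hu]
      linarith

theorem exists_positive_dominating_of_bound (ω : A →L[ℂ] ℂ) {δ : ℝ} (hδ : 0 < δ)
    (hω : ∀ b, ‖ω b‖ ≤ δ * ‖b‖) :
    ∃ σ : A →ₚ[ℂ] ℂ, (∀ a, 0 ≤ a → (σ a).re ≤ δ ^ 2 * ‖a‖) ∧
      ∀ b, ‖ω b‖ ^ 2 ≤ (σ (star b * b)).re := by
  obtain ⟨σ, h1, h2⟩ := exists_positive_dominating (((δ⁻¹ : ℝ) : ℂ) • ω) fun b => by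
    rw [smul_apply, norm_smul, Complex.norm_real,
      Real.norm_of_nonneg (by positivity), inv_mul_le_iff₀ hδ]
    exact hω b
  refine ⟨PositiveLinearMap.mk₀ (((δ ^ 2 : ℝ) : ℂ) • σ.toLinearMap) fun a ha =>
    mul_nonneg (by exact_mod_cast sq_nonneg δ) (σ.map_nonneg ha), fun a ha => ?_, fun b => ?_⟩
  · change (((δ ^ 2 : ℝ) : ℂ) * σ a).re ≤ _
    rw [Complex.re_ofReal_mul]
    gcongr
    exact h1 a ha
  · change _ ≤ (((δ ^ 2 : ℝ) : ℂ) * σ (star b * b)).re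
    rw [Complex.re_ofReal_mul, ← inv_mul_le_iff₀ (by positivity)]
    refine le_trans (le_of_eq ?_) (h2 b)
    rw [smul_apply, norm_smul, Complex.norm_real,
      Real.norm_of_nonneg (by positivity), mul_pow, inv_pow]

namespace PositiveLinearMap

variable (f : A →ₚ[ℂ] ℂ)

/-- The class of `a` in the GNS space. -/
noncomputable def toGNS : A →ₗ[ℂ] f.GNS :=
  (UniformSpace.Completion.toComplL (𝕜 := ℂ) (E := f.PreGNS)).toLinearMap ∘ₗ
    f.toPreGNS.toLinearMap

theorem toGNS_apply (a : A) : f.toGNS a = (f.toPreGNS a : f.GNS) := rfl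

theorem inner_toGNS (a b : A) : ⟪f.toGNS a, f.toGNS b⟫_ℂ = f (star a * b) := by
  rw [toGNS_apply, toGNS_apply, UniformSpace.Completion.inner_coe, preGNS_inner_def]
  simp

theorem norm_toGNS_sq (a : A) : ‖f.toGNS a‖ ^ 2 = (f (star a * a)).re := by
  rw [← inner_self_eq_norm_sq (𝕜 := ℂ), inner_toGNS]
  rfl

theorem denseRange_toGNS : DenseRange f.toGNS :=
  UniformSpace.Completion.denseRange_coe.comp f.toPreGNS.surjective.denseRange
    (UniformSpace.Completion.continuous_coe _)

theorem gns_apply_toGNS (a b : A) :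
    f.gnsNonUnitalStarAlgHom a (f.toGNS b) = f.toGNS (a * b) := by
  rw [toGNS_apply, gnsNonUnitalStarAlgHom_apply_coe]
  rfl

omit [StarOrderedRing A] in
theorem apply_re_nonneg {a : A} (ha : 0 ≤ a) : 0 ≤ (f a).re :=
  (Complex.nonneg_iff.1 (f.map_nonneg ha)).1

omit [StarOrderedRing A] in
theorem coe_re_apply {a : A} (ha : 0 ≤ a) : ((f a).re : ℂ) = f a :=
  Complex.ext rfl (Complex.nonneg_iff.1 (f.map_nonneg ha)).2

theorem norm_toGNS_le {K : ℝ} (hK : ∀ a, 0 ≤ a → (f a).re ≤ K * ‖a‖) (a : A) :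
    ‖f.toGNS a‖ ≤ √K * ‖a‖ := by
  rcases eq_or_ne a 0 with rfl | ha
  · simp
  have h := hK _ (star_mul_self_nonneg a)
  have h0 := f.apply_re_nonneg (star_mul_self_nonneg a)
  rw [CStarRing.norm_star_mul_self] at h
  have hK0 : 0 ≤ K := nonneg_of_mul_nonneg_left (h0.trans h) (by positivity)
  refine le_of_sq_le_sq ?_ (by positivity)
  rw [norm_toGNS_sq, mul_pow, Real.sq_sqrt hK0]
  linarith

theorem re_apply_le (a : A) :
    (f a).re ≤ ‖(⟨f.toLinearMap, map_continuous f⟩ : A →L[ℂ] ℂ)‖ * ‖a‖ :=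
  (Complex.re_le_norm _).trans
    ((⟨f.toLinearMap, map_continuous f⟩ : A →L[ℂ] ℂ).le_opNorm a)

theorem norm_apply_le_toGNS {K : ℝ} (hK : ∀ a, 0 ≤ a → (f a).re ≤ K * ‖a‖) (a : A) :
    ‖f a‖ ≤ √K * ‖f.toGNS a‖ := by
  have hl := CStarAlgebra.increasingApproximateUnit A
  have := hl.neBot
  -- An approximate unit replaces `1` in the Cauchy–Schwarz bound for `f (1 * a)`.
  have hlim : Tendsto (fun e => ‖f (e * a)‖) (CStarAlgebra.approximateUnit A) (𝓝 ‖f a‖) :=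
    (((map_continuous f).tendsto a).comp (hl.tendsto_mul_right a)).norm
  refine le_of_tendsto hlim ?_
  filter_upwards [hl.eventually_nonneg, hl.eventually_norm] with e he he1
  have h1 : ‖f.toGNS e‖ ≤ √K := (f.norm_toGNS_le hK e).trans
    (mul_le_of_le_one_right (Real.sqrt_nonneg _) he1)
  calc ‖f (e * a)‖ = ‖⟪f.toGNS e, f.toGNS a⟫_ℂ‖ := by
        rw [inner_toGNS, (IsSelfAdjoint.of_nonneg he).star_eq]
    _ ≤ ‖f.toGNS e‖ * ‖f.toGNS a‖ := norm_inner_le_norm _ _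
    _ ≤ _ := by gcongr

/-- A functional on `A` that is bounded in the GNS seminorm of `f` is represented by a vector. -/
theorem exists_gns_representing (ω : A →ₗ[ℂ] ℂ) {K : ℝ} (hω : ∀ a, ‖ω a‖ ≤ K * ‖f.toGNS a‖) :
    ∃ ξ : f.GNS, ∀ a, ⟪ξ, f.toGNS a⟫_ℂ = ω a := by
  let g : f.PreGNS →L[ℂ] ℂ := (ω ∘ₗ f.ofPreGNS.toLinearMap).mkContinuous K fun a => by
    have := hω (f.ofPreGNS a)
    rwa [toGNS_apply, UniformSpace.Completion.norm_coe] at this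
  let G : f.GNS →L[ℂ] ℂ := g.fromCompletion
  refine ⟨(InnerProductSpace.toDual ℂ f.GNS).symm G, fun a => ?_⟩
  rw [InnerProductSpace.toDual_symm_apply, toGNS_apply]
  exact ContinuousLinearMap.fromCompletion_apply_coe g _

theorem inner_gns_star_apply (a : A) (x y : f.GNS) :
    ⟪f.gnsNonUnitalStarAlgHom (star a) x, y⟫_ℂ = ⟪x, f.gnsNonUnitalStarAlgHom a y⟫_ℂ := by
  rw [map_star, ContinuousLinearMap.star_eq_adjoint, ContinuousLinearMap.adjoint_inner_left]

/-- The cyclic vector of the GNS representation. -/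
theorem exists_gns_cyclic :
    ∃ ξ : f.GNS, (∀ a, ⟪ξ, f.toGNS a⟫_ℂ = f a) ∧ ∀ a, f.gnsNonUnitalStarAlgHom a ξ = f.toGNS a := by
  -- There is no class of `1` to use, so the vector comes from the Riesz representation of `f`
  -- itself.
  obtain ⟨ξ, hξ⟩ := f.exists_gns_representing f.toLinearMap
    (f.norm_apply_le_toGNS fun a _ => f.re_apply_le a)
  refine ⟨ξ, hξ, fun a => f.denseRange_toGNS.eq_of_inner_right ℂ fun b => ?_⟩
  rw [← inner_gns_star_apply, gns_apply_toGNS, ← inner_conj_symm, hξ, inner_toGNS]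
  change star (f (star a * b)) = _
  rw [← map_star, star_mul, star_star]

theorem inner_gns_star_mul_self_apply (b : A) (x : f.GNS) :
    ⟪x, f.gnsNonUnitalStarAlgHom (star b * b) x⟫_ℂ
      = ((‖f.gnsNonUnitalStarAlgHom b x‖ ^ 2 : ℝ) : ℂ) := by
  rw [map_mul, mul_apply_eq_comp, ← inner_gns_star_apply, star_star, inner_self_eq_norm_sq_to_K]
  push_cast
  rfl

/-- A bound for a positive functional on positive elements is a bound for its norm. -/
theorem norm_apply_le_of_nonneg_bound {K : ℝ} (hK0 : 0 ≤ K)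
    (hK : ∀ a, 0 ≤ a → (f a).re ≤ K * ‖a‖) (a : A) : ‖f a‖ ≤ K * ‖a‖ := by
  have h1 := f.norm_apply_le_toGNS hK a
  have h2 := mul_le_mul_of_nonneg_left (f.norm_toGNS_le hK a) (Real.sqrt_nonneg K)
  rw [← mul_assoc, Real.mul_self_sqrt hK0] at h2
  exact h1.trans h2

end PositiveLinearMap

end PositiveFunctionals

/-! ### Parallel sums of positive functionals, and the norm bound for pure states. -/

/-- Orthogonal projection of `(0, ξ)` onto the pairs `(α, β)` with `S⋆ α = T⋆ β`. -/
theorem exists_projection_matching {V H₁ H₂ : Type*} [AddCommGroup V] [Module ℂ V]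
    [NormedAddCommGroup H₁] [InnerProductSpace ℂ H₁] [CompleteSpace H₁]
    [NormedAddCommGroup H₂] [InnerProductSpace ℂ H₂] [CompleteSpace H₂]
    (S : V →ₗ[ℂ] H₁) (T : V →ₗ[ℂ] H₂) (ξ : H₂) :
    ∃ α β, (∀ c, ⟪S c, α⟫_ℂ = ⟪T c, β⟫_ℂ) ∧ ∀ α' β', (∀ c, ⟪S c, α'⟫_ℂ = ⟪T c, β'⟫_ℂ) →
      ⟪α', α⟫_ℂ + ⟪β', β⟫_ℂ = ⟪β', ξ⟫_ℂ := by
  let R : V →ₗ[ℂ] WithLp 2 (H₁ × H₂) :=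
    (WithLp.linearEquiv 2 ℂ (H₁ × H₂)).symm.toLinearMap ∘ₗ (S.prod (-T))
  have hR : ∀ c, R c = WithLp.toLp 2 (S c, -T c) := fun c => rfl
  -- The matching pairs are exactly `Mᗮ`, hence a closed subspace.
  let M := LinearMap.range R
  have hM : ∀ v, v ∈ Mᗮ ↔ ∀ c, ⟪S c, v.ofLp.1⟫_ℂ = ⟪T c, v.ofLp.2⟫_ℂ := fun v => by
    rw [Submodule.mem_orthogonal]
    constructor
    · intro h c
      have := h (R c) ⟨c, rfl⟩
      rw [hR, WithLp.prod_inner_apply] at this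
      simp only [inner_neg_left] at this
      exact eq_of_sub_eq_zero (by rw [sub_eq_add_neg]; exact this)
    · rintro h _ ⟨c, rfl⟩
      rw [hR, WithLp.prod_inner_apply]
      simp only [inner_neg_left, h c, add_neg_cancel]
  have : CompleteSpace Mᗮ := M.isClosed_orthogonal.completeSpace_coe
  have : Mᗮ.HasOrthogonalProjection := .ofCompleteSpace Mᗮ
  obtain ⟨y, hy, z, hz, hyz⟩ := Submodule.exists_add_mem_mem_orthogonal (K := Mᗮ)
    (WithLp.toLp 2 ((0 : H₁), ξ))
  refine ⟨_, _, (hM y).1 hy, fun α' β' h' => ?_⟩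
  have h1 := Submodule.inner_right_of_mem_orthogonal
    ((hM (WithLp.toLp 2 (α', β'))).2 h') hz
  have h2 : ⟪WithLp.toLp 2 (α', β'), WithLp.toLp 2 ((0 : H₁), ξ)⟫_ℂ
      = ⟪WithLp.toLp 2 (α', β'), y⟫_ℂ := by
    rw [hyz, inner_add_right, h1, add_zero]
  rw [WithLp.prod_inner_apply, WithLp.prod_inner_apply] at h2
  simpa using h2.symm

section PureStates

variable {A : Type*} [NonUnitalCStarAlgebra A] [PartialOrder A] [StarOrderedRing A]

namespace PositiveLinearMap

variable (f g : A →ₚ[ℂ] ℂ)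

/-- The pairs of GNS vectors that define the same functional on `A`. -/
def GNSMatch (α : f.GNS) (β : g.GNS) : Prop :=
  ∀ c, ⟪f.toGNS c, α⟫_ℂ = ⟪g.toGNS c, β⟫_ℂ

variable {f g} in
theorem GNSMatch.map {α : f.GNS} {β : g.GNS} (h : GNSMatch f g α β) (b : A) :
    GNSMatch f g (f.gnsNonUnitalStarAlgHom b α) (g.gnsNonUnitalStarAlgHom b β) := fun c => by
  rw [← inner_gns_star_apply, ← inner_gns_star_apply, gns_apply_toGNS, gns_apply_toGNS]
  exact h _

theorem exists_gnsMatch_projection (ξ : g.GNS) :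
    ∃ α β, GNSMatch f g α β ∧ ∀ α' β', GNSMatch f g α' β' →
      ⟪α', α⟫_ℂ + ⟪β', β⟫_ℂ = ⟪β', ξ⟫_ℂ :=
  exists_projection_matching f.toGNS g.toGNS ξ

/-- The positive functional `a ↦ ⟪α, a α⟫ + ⟪β, a β⟫`. -/
noncomputable def gnsVectorSum (α : f.GNS) (β : g.GNS) : A →ₚ[ℂ] ℂ :=
  PositiveLinearMap.mk₀
    { toFun := fun a => ⟪α, f.gnsNonUnitalStarAlgHom a α⟫_ℂ + ⟪β, g.gnsNonUnitalStarAlgHom a β⟫_ℂ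
      map_add' := fun a b => by
        simp only [map_add, _root_.add_apply, inner_add_right]; ring
      map_smul' := fun c a => by
        simp only [map_smul, smul_apply, inner_smul_right, RingHom.id_apply,
          smul_eq_mul]; ring } fun a ha => by
    obtain ⟨b, rfl⟩ := CStarAlgebra.nonneg_iff_eq_star_mul_self.1 ha
    rw [LinearMap.coe_mk, AddHom.coe_mk, inner_gns_star_mul_self_apply,
      inner_gns_star_mul_self_apply]
    exact_mod_cast add_nonneg (sq_nonneg _) (sq_nonneg _)

theorem gnsVectorSum_star_mul_self (α : f.GNS) (β : g.GNS) (b : A) :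
    (gnsVectorSum f g α β (star b * b)).re
      = ‖f.gnsNonUnitalStarAlgHom b α‖ ^ 2 + ‖g.gnsNonUnitalStarAlgHom b β‖ ^ 2 := by
  change (⟪α, f.gnsNonUnitalStarAlgHom (star b * b) α⟫_ℂ
    + ⟪β, g.gnsNonUnitalStarAlgHom (star b * b) β⟫_ℂ).re = _
  rw [inner_gns_star_mul_self_apply, inner_gns_star_mul_self_apply, ← Complex.ofReal_add,
    Complex.ofReal_re]

theorem le_of_re_star_mul_self_le (h : ∀ b, (f (star b * b)).re ≤ (g (star b * b)).re) (a : A)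
    (ha : 0 ≤ a) : f a ≤ g a := by
  rw [← f.coe_re_apply ha, ← g.coe_re_apply ha]
  obtain ⟨b, rfl⟩ := CStarAlgebra.nonneg_iff_eq_star_mul_self.1 ha
  exact_mod_cast h b

/-- The parallel sum of two positive functionals: it lies below both and, up to a factor `2`,
dominates every functional that is contractive in both GNS seminorms. -/
theorem exists_parallel_sum :
    ∃ ρ : A →ₚ[ℂ] ℂ, (∀ a, 0 ≤ a → ρ a ≤ f a) ∧ (∀ a, 0 ≤ a → ρ a ≤ g a) ∧
      ∀ ω : A →ₗ[ℂ] ℂ, (∀ b, ‖ω b‖ ^ 2 ≤ (f (star b * b)).re) →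
        (∀ b, ‖ω b‖ ^ 2 ≤ (g (star b * b)).re) → ∀ b, ‖ω b‖ ^ 2 ≤ 2 * (ρ (star b * b)).re := by
  obtain ⟨ξ, -, hξ⟩ := g.exists_gns_cyclic
  obtain ⟨α, β, hαβ, hproj⟩ := exists_gnsMatch_projection f g ξ
  -- Matching pairs are invariant under the diagonal action of `A`, so the projection commutes with
  -- it: `(b α, b β)` is the projection of `(0, b ξ)`.
  have key : ∀ b α' β', GNSMatch f g α' β' →
      ⟪α', f.gnsNonUnitalStarAlgHom b α⟫_ℂ + ⟪β', g.gnsNonUnitalStarAlgHom b β⟫_ℂ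
        = ⟪β', g.toGNS b⟫_ℂ := fun b α' β' h' => by
    rw [← inner_gns_star_apply, ← inner_gns_star_apply, hproj _ _ (h'.map (star b)), ← hξ,
      inner_gns_star_apply]
  have hnorm : ∀ b, ((‖f.gnsNonUnitalStarAlgHom b α‖ ^ 2 + ‖g.gnsNonUnitalStarAlgHom b β‖ ^ 2 : ℝ) : ℂ)
      = ⟪g.gnsNonUnitalStarAlgHom b β, g.toGNS b⟫_ℂ := fun b => by
    rw [← key b _ _ (hαβ.map b), inner_self_eq_norm_sq_to_K, inner_self_eq_norm_sq_to_K]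
    push_cast
    rfl
  have hnorm' : ∀ b, ((‖f.gnsNonUnitalStarAlgHom b α‖ ^ 2 + ‖g.gnsNonUnitalStarAlgHom b β‖ ^ 2 : ℝ) : ℂ)
      = ⟪f.gnsNonUnitalStarAlgHom b α, f.toGNS b⟫_ℂ := fun b => by
    rw [hnorm, ← inner_conj_symm, ← (hαβ.map b) b, inner_conj_symm]
  refine ⟨gnsVectorSum f g α β, le_of_re_star_mul_self_le _ _ fun b => ?_,
    le_of_re_star_mul_self_le _ _ fun b => ?_, fun ω hf hg b => ?_⟩
  · rw [gnsVectorSum_star_mul_self, ← norm_toGNS_sq]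
    have h1 := norm_inner_le_norm (𝕜 := ℂ) (f.gnsNonUnitalStarAlgHom b α) (f.toGNS b)
    rw [← hnorm', Complex.norm_real, Real.norm_of_nonneg (by positivity)] at h1
    nlinarith [sq_nonneg (‖f.gnsNonUnitalStarAlgHom b α‖ - ‖f.toGNS b‖),
      sq_nonneg ‖g.gnsNonUnitalStarAlgHom b β‖]
  · rw [gnsVectorSum_star_mul_self, ← norm_toGNS_sq]
    have h1 := norm_inner_le_norm (𝕜 := ℂ) (g.gnsNonUnitalStarAlgHom b β) (g.toGNS b)
    rw [← hnorm, Complex.norm_real, Real.norm_of_nonneg (by positivity)] at h1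
    nlinarith [sq_nonneg (‖g.gnsNonUnitalStarAlgHom b β‖ - ‖g.toGNS b‖),
      sq_nonneg ‖f.gnsNonUnitalStarAlgHom b α‖]
  -- The vectors representing `ω` in the two GNS spaces match, so `key` expresses `ω b` through `b
  -- α` and `b β`. The factor `2` is `(p + q)² ≤ 2 (p² + q²)`.
  · have hrep : ∀ p : A →ₚ[ℂ] ℂ, (∀ b, ‖ω b‖ ^ 2 ≤ (p (star b * b)).re) →
        ∃ η : p.GNS, ‖η‖ ≤ 1 ∧ ∀ a, ⟪η, p.toGNS a⟫_ℂ = ω a := fun p hp => by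
      have hp' : ∀ b, ‖ω b‖ ≤ 1 * ‖p.toGNS b‖ := fun b => by
        rw [one_mul]
        exact le_of_sq_le_sq (by rw [norm_toGNS_sq]; exact hp b) (norm_nonneg _)
      obtain ⟨η, hη⟩ := p.exists_gns_representing ω hp'
      refine ⟨η, ?_, hη⟩
      have hall : ∀ x, ‖⟪η, x⟫_ℂ‖ ≤ ‖x‖ := fun x =>
        p.denseRange_toGNS.induction_on x
          (isClosed_le (by fun_prop) (by fun_prop)) fun b => by
            rw [hη]; simpa using hp' b
      have := hall η
      rw [inner_self_eq_norm_sq_to_K] at this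
      simp only [norm_pow, RCLike.norm_ofReal, abs_norm] at this
      by_contra! h
      nlinarith
    obtain ⟨η, hη1, hη⟩ := hrep f hf
    obtain ⟨θ, hθ1, hθ⟩ := hrep g hg
    have hm : GNSMatch f g η θ := fun c => by
      rw [← inner_conj_symm, hη, ← inner_conj_symm, hθ]
    rw [gnsVectorSum_star_mul_self, ← hθ, ← key b η θ hm]
    have h1 := norm_inner_le_norm (𝕜 := ℂ) η (f.gnsNonUnitalStarAlgHom b α)
    have h2 := norm_inner_le_norm (𝕜 := ℂ) θ (g.gnsNonUnitalStarAlgHom b β)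
    have h3 : ‖⟪η, f.gnsNonUnitalStarAlgHom b α⟫_ℂ + ⟪θ, g.gnsNonUnitalStarAlgHom b β⟫_ℂ‖
        ≤ ‖f.gnsNonUnitalStarAlgHom b α‖ + ‖g.gnsNonUnitalStarAlgHom b β‖ :=
      (norm_add_le _ _).trans (add_le_add
        (h1.trans (mul_le_of_le_one_left (norm_nonneg _) hη1))
        (h2.trans (mul_le_of_le_one_left (norm_nonneg _) hθ1)))
    have h4 := pow_le_pow_left₀ (norm_nonneg _) h3 2
    nlinarith [sq_nonneg (‖f.gnsNonUnitalStarAlgHom b α‖ - ‖g.gnsNonUnitalStarAlgHom b β‖)]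

end PositiveLinearMap

/-- Vector functionals `b ↦ ⟪η, b ξ⟫` in the GNS representation of a pure state are bounded
below in norm. -/
theorem IsPureState.norm_le_of_bound {f : A →ₚ[ℂ] ℂ} (hf : IsPureState f) {η : f.GNS}
    (hη : ‖η‖ = 1) {δ : ℝ} (hδ : 0 < δ) (hb : ∀ b, ‖⟪η, f.toGNS b⟫_ℂ‖ ≤ δ * ‖b‖) :
    1 ≤ 2 * δ ^ 2 := by
  let ω₀ : A →ₗ[ℂ] ℂ := (innerSL ℂ η).toLinearMap ∘ₗ f.toGNS
  obtain ⟨σ, hσ, hωσ⟩ := exists_positive_dominating_of_bound (ω₀.mkContinuous δ hb) hδ hb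
  obtain ⟨ρ, hρf, hρσ, hρ⟩ := PositiveLinearMap.exists_parallel_sum f σ
  have hωf : ∀ b, ‖ω₀ b‖ ^ 2 ≤ (f (star b * b)).re := fun b => by
    rw [← f.norm_toGNS_sq]
    have := norm_inner_le_norm (𝕜 := ℂ) η (f.toGNS b)
    rw [hη, one_mul] at this
    exact pow_le_pow_left₀ (norm_nonneg _) this 2
  obtain ⟨t, ⟨ht0, -⟩, ht⟩ := hf.2 ρ hρf
  -- From `t • f = ρ ≤ σ`, the state `f` has norm at most `δ ^ 2 / t`.
  have htδ : t ≤ δ ^ 2 := by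
    rcases ht0.eq_or_lt with rfl | htpos
    · positivity
    have h1 : ∀ a, 0 ≤ a → (f a).re ≤ δ ^ 2 / t * ‖a‖ := fun a ha => by
      have h2 := (Complex.le_def.1 (hρσ a ha)).1
      rw [ht, Complex.re_ofReal_mul] at h2
      rw [div_mul_eq_mul_div, le_div_iff₀ htpos]
      linarith [hσ a ha]
    have h3 := f.norm_apply_le_of_nonneg_bound (by positivity) h1
    have h4 : (1 : ℝ) ≤ δ ^ 2 / t := by
      rw [← hf.1]
      exact ContinuousLinearMap.opNorm_le_bound _ (by positivity) h3
    rwa [one_le_div htpos] at h4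
  have hall : ∀ x : f.GNS, ‖⟪η, x⟫_ℂ‖ ^ 2 ≤ 2 * t * ‖x‖ ^ 2 := fun x =>
    f.denseRange_toGNS.induction_on x (isClosed_le (by fun_prop) (by fun_prop)) fun b => by
      have := hρ ω₀ hωf hωσ b
      rw [ht, Complex.re_ofReal_mul, ← f.norm_toGNS_sq] at this
      rw [mul_assoc]
      exact this
  have := hall η
  rw [inner_self_eq_norm_sq_to_K, hη] at this
  norm_num at this
  linarith

end PureStates

/-! ### Surjectivity from a lower bound on the adjoint. -/

section ClosedRange

variable {E H : Type*} [NormedAddCommGroup E] [NormedSpace ℂ E]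
  [NormedAddCommGroup H] [InnerProductSpace ℂ H] [CompleteSpace H]

/-- If the adjoint of `T` is bounded below by `c`, then the closure of the image of the unit ball
contains the ball of radius `c`. -/
theorem mem_closure_image_ball_of_adjoint_bound (T : E →L[ℂ] H) {c : ℝ}
    (h : ∀ η : H, ‖η‖ = 1 → ∀ δ > 0, (∀ b, ‖⟪η, T b⟫_ℂ‖ ≤ δ * ‖b‖) → c ≤ δ) {y : H}
    (hy : ‖y‖ < c) : y ∈ closure (T '' Metric.ball 0 1) := by
  by_contra hmem
  have hconv : Convex ℝ (closure (T '' Metric.ball 0 1)) :=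
    ((convex_ball (0 : E) 1).linear_image (T.toLinearMap.restrictScalars ℝ)).closure
  obtain ⟨F, u, hF, hu⟩ := RCLike.geometric_hahn_banach_closed_point (𝕜 := ℂ)
    hconv isClosed_closure hmem
  simp only [RCLike.re_to_complex] at hF hu
  obtain ⟨η, rfl⟩ := (InnerProductSpace.toDual ℂ H).surjective F
  simp only [InnerProductSpace.toDual_apply_apply] at hF hu
  have hball : ∀ b, ‖b‖ < 1 → (⟪η, T b⟫_ℂ).re < u := fun b hb =>
    hF _ (subset_closure ⟨b, by simpa using hb, rfl⟩)
  have hu0 : 0 < u := by simpa using hball 0 (by simp)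
  have hbound : ∀ b, ‖⟪η, T b⟫_ℂ‖ ≤ u * ‖b‖ := fun b => by
    refine le_of_forall_pos_le_add fun ε hε => ?_
    set r := ‖b‖ + ε / u with hr
    have hε' : 0 < ε / u := by positivity
    have hr0 : 0 < r := by positivity
    rcases eq_or_ne ⟪η, T b⟫_ℂ 0 with h0 | h0
    · rw [h0, norm_zero]; positivity
    set z := ⟪η, T b⟫_ℂ with hz
    have hz0 : 0 < ‖z‖ := norm_pos_iff.2 h0
    -- The phase `star z / ‖z‖` turns a bound on real parts into one on absolute values.
    have h1 := hball ((((r * ‖z‖)⁻¹ : ℝ) * star z : ℂ) • b) (by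
      rw [norm_smul, norm_mul, Complex.norm_real, norm_star,
        Real.norm_of_nonneg (by positivity), mul_inv, mul_assoc (r⁻¹), inv_mul_cancel₀ hz0.ne',
        mul_one, inv_mul_lt_one₀ hr0]
      linarith)
    rw [map_smul, inner_smul_right, ← hz, mul_assoc, Complex.star_def, ← Complex.normSq_eq_conj_mul_self,
      ← Complex.ofReal_mul, Complex.ofReal_re, Complex.normSq_eq_norm_sq] at h1
    have h2 : (r * ‖z‖)⁻¹ * ‖z‖ ^ 2 = r⁻¹ * ‖z‖ := by field_simp
    rw [h2, inv_mul_lt_iff₀ hr0, hr, add_mul, div_mul_cancel₀ _ hu0.ne'] at h1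
    linarith
  have hη : η ≠ 0 := by
    rintro rfl
    simp at hu
    linarith
  have hη0 : 0 < ‖η‖ := norm_pos_iff.2 hη
  have h3 := h (((‖η‖⁻¹ : ℝ) : ℂ) • η) (by
      rw [norm_smul, Complex.norm_real, norm_inv, norm_norm, inv_mul_cancel₀ hη0.ne'])
    (u / ‖η‖) (by positivity) fun b => by
      rw [inner_smul_left, norm_mul, RCLike.norm_conj, Complex.norm_real, norm_inv, norm_norm,
        div_eq_inv_mul, mul_assoc]
      exact mul_le_mul_of_nonneg_left (hbound b) (by positivity)
  rw [le_div_iff₀ hη0] at h3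
  have h4 : (⟪η, y⟫_ℂ).re ≤ ‖η‖ * ‖y‖ := re_inner_le_norm (𝕜 := ℂ) η y
  nlinarith

/-- The iteration of the open mapping theorem: each approximate preimage halves the error, and the
corrections form a summable series. -/
theorem surjective_of_adjoint_bound [CompleteSpace E] (T : E →L[ℂ] H) {c : ℝ} (hc : 0 < c)
    (h : ∀ η : H, ‖η‖ = 1 → ∀ δ > 0, (∀ b, ‖⟪η, T b⟫_ℂ‖ ≤ δ * ‖b‖) → c ≤ δ) :
    Function.Surjective T := by
  have hC : ∀ y, ∃ x, ‖y - T x‖ ≤ 1 / 2 * ‖y‖ ∧ ‖x‖ ≤ 2 / c * ‖y‖ := fun y => by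
    rcases eq_or_ne y 0 with rfl | hy
    · exact ⟨0, by simp⟩
    -- Scaling `y` to norm `c / 2` places it in the ball of radius `c`; an error below `c / 4` is
    -- then half its norm.
    have hy0 : 0 < ‖y‖ := norm_pos_iff.2 hy
    set s : ℝ := c / (2 * ‖y‖) with hs
    have hs0 : 0 < s := by positivity
    have hsy : s * ‖y‖ = c / 2 := by rw [hs]; field_simp
    have h1 := mem_closure_image_ball_of_adjoint_bound T h (y := (s : ℂ) • y) (by
      rw [norm_smul, Complex.norm_real, Real.norm_of_nonneg hs0.le, hsy]; linarith)
    obtain ⟨_, ⟨b, hb, rfl⟩, hbd⟩ := Metric.mem_closure_iff.1 h1 (c / 4) (by positivity)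
    rw [mem_ball_zero_iff] at hb
    have hs' : (s : ℂ) ≠ 0 := by exact_mod_cast hs0.ne'
    refine ⟨((s⁻¹ : ℝ) : ℂ) • b, ?_, ?_⟩
    · have h2 : y - T (((s⁻¹ : ℝ) : ℂ) • b) = ((s⁻¹ : ℝ) : ℂ) • ((s : ℂ) • y - T b) := by
        rw [map_smul, smul_sub, smul_smul, Complex.ofReal_inv, inv_mul_cancel₀ hs', one_smul]
      rw [h2, norm_smul, Complex.norm_real, Real.norm_of_nonneg (by positivity),
        inv_mul_le_iff₀ hs0]
      rw [dist_eq_norm] at hbd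
      linarith
    · rw [norm_smul, Complex.norm_real, Real.norm_of_nonneg (by positivity), inv_mul_le_iff₀ hs0]
      have : s * (2 / c * ‖y‖) = 1 := by rw [hs]; field_simp
      linarith
  choose g hg using hC
  intro y
  let h y := y - T (g y)
  have hnle : ∀ n : ℕ, ‖h^[n] y‖ ≤ (1 / 2) ^ n * ‖y‖ := fun n => by
    induction n with
    | zero => simp
    | succ n ih =>
      rw [Function.iterate_succ_apply', pow_succ', mul_assoc]
      exact (hg _).1.trans (by gcongr)
  have ule : ∀ n, ‖g (h^[n] y)‖ ≤ (1 / 2) ^ n * (2 / c * ‖y‖) := fun n => by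
    refine (hg _).2.trans ?_
    calc 2 / c * ‖h^[n] y‖ ≤ 2 / c * ((1 / 2) ^ n * ‖y‖) := by gcongr; exact hnle n
      _ = _ := by ring
  have su : Summable fun n => g (h^[n] y) :=
    .of_norm_bounded ((summable_geometric_of_lt_one (by norm_num) (by norm_num)).mul_right _) ule
  have hsum : ∀ n : ℕ, T (∑ i ∈ Finset.range n, g (h^[i] y)) = y - h^[n] y := fun n => by
    induction n with
    | zero => simp
    | succ n ih => rw [Finset.sum_range_succ, map_add, ih, Function.iterate_succ_apply', sub_add]
  have L₁ := (T.continuous.tendsto _).comp su.hasSum.tendsto_sum_nat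
  have L₂ : Tendsto (fun n => y - h^[n] y) atTop (𝓝 (y - 0)) := by
    refine tendsto_const_nhds.sub (squeeze_zero_norm hnle ?_)
    rw [← zero_mul ‖y‖]
    exact (tendsto_pow_atTop_nhds_zero_of_lt_one (by norm_num) (by norm_num)).mul_const _
  refine ⟨_, (tendsto_nhds_unique L₁ (L₂.congr fun n => (hsum n).symm)).trans (sub_zero y)⟩

end ClosedRange

/-! ### Modular right ideals and right kernels of pure states. -/

section ModularIdeals

variable {A : Type*} [NonUnitalCStarAlgebra A]

/-- The Neumann series is applied to left multiplication by `w`, in the unital algebra of bounded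
operators on `A`. -/
theorem exists_sub_mul_eq {w : A} (hw : ‖w‖ < 1) (a : A) : ∃ c, c - w * c = a := by
  have h : ‖ContinuousLinearMap.mul ℂ A w‖ < 1 :=
    (ContinuousLinearMap.opNorm_mul_apply_le ℂ A w).trans_lt hw
  refine ⟨(↑(Units.oneSub _ h)⁻¹ : A →L[ℂ] A) a, ?_⟩
  have := congrArg (fun S : A →L[ℂ] A => S a) (Units.oneSub _ h).mul_inv
  simpa using this

theorem IsModularRightIdeal.exists_le_maximal {I : Submodule ℂ A} (hI : IsModularRightIdeal I)
    (hne : I ≠ ⊤) : ∃ M, IsMaximalModularRightIdeal M ∧ I ≤ M := by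
  obtain ⟨hmul, v, hv⟩ := hI
  have htop : ∀ K : Submodule ℂ A, (∀ a ∈ K, ∀ b : A, a * b ∈ K) → (∀ a, v * a - a ∈ K) →
      v ∈ K → K = ⊤ := fun K h1 h2 h3 => by
    refine Submodule.eq_top_iff'.2 fun a => ?_
    have := K.sub_mem (h1 v h3 a) (h2 a)
    rwa [sub_sub_cancel] at this
  -- With `v` fixed, properness amounts to `v ∉ K`, which survives unions of chains. Any larger
  -- ideal keeps `v` as modular unit, so maximality in `S` is maximality among all proper modular
  -- right ideals.
  let S : Set (Submodule ℂ A) :=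
    {K | (∀ a ∈ K, ∀ b : A, a * b ∈ K) ∧ (∀ a, v * a - a ∈ K) ∧ v ∉ K}
  obtain ⟨M, hIM, hM⟩ := zorn_le_nonempty₀ S (fun C hC hchain K hK => by
      have hmem : ∀ {x}, x ∈ sSup C ↔ ∃ L ∈ C, x ∈ L := fun {x} =>
        Submodule.mem_sSup_of_directed ⟨K, hK⟩ hchain.directedOn
      refine ⟨sSup C, ⟨fun a ha b => ?_, fun a => ?_, fun hvC => ?_⟩, fun L hL => le_sSup hL⟩
      · obtain ⟨L, hL, haL⟩ := hmem.1 ha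
        exact hmem.2 ⟨L, hL, (hC hL).1 a haL b⟩
      · exact hmem.2 ⟨K, hK, (hC hK).2.1 a⟩
      · obtain ⟨L, hL, hvL⟩ := hmem.1 hvC
        exact (hC hL).2.2 hvL)
    I ⟨hmul, hv, fun h => hne (htop I hmul hv h)⟩
  refine ⟨M, ⟨⟨⟨hM.prop.1, v, hM.prop.2.1⟩, ?_⟩, fun K hK hMK => ?_⟩, hIM⟩
  · rintro rfl
    exact hM.prop.2.2 trivial
  · have hvK : ∀ a, v * a - a ∈ K := fun a => hMK (hM.prop.2.1 a)
    exact hM.le_of_ge ⟨hK.1.1, hvK, fun h => hK.2 (htop K hK.1.1 hvK h)⟩ hMK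

theorem IsApproxRightInvertible.notMem_of_isModularRightIdeal {x : A}
    (hx : IsApproxRightInvertible x) {I : Submodule ℂ A} (hI : IsModularRightIdeal I)
    (hne : I ≠ ⊤) : x ∉ I := by
  intro hxI
  obtain ⟨hmul, v, hv⟩ := hI
  obtain ⟨J, _, _, _, r, hr⟩ := hx
  obtain ⟨j, hj⟩ := (((hr v).1).eventually (Metric.ball_mem_nhds v one_pos)).exists
  have hy : x * r j * v ∈ I := hmul _ (hmul x hxI _) _
  refine hne (Submodule.eq_top_iff'.2 fun a => ?_)
  obtain ⟨c, rfl⟩ := exists_sub_mul_eq (w := v - x * r j * v)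
    (by rw [← dist_eq_norm, dist_comm]; exact hj) a
  have : c - (v - x * r j * v) * c = x * r j * v * c - (v * c - c) := by rw [sub_mul]; abel
  rw [this]
  exact I.sub_mem (hmul _ hy c) (hv c)

variable [PartialOrder A] [StarOrderedRing A]

theorem IsPureState.surjective_toGNS {f : A →ₚ[ℂ] ℂ} (hf : IsPureState f) :
    Function.Surjective f.toGNS := by
  have hb := f.norm_toGNS_le fun a _ => f.re_apply_le a
  -- `1 ≤ 2 * δ ^ 2` gives `δ ≥ 1 / √2`, so `1 / 2` is a safe constant.
  have := surjective_of_adjoint_bound (f.toGNS.mkContinuous _ hb) (c := 1 / 2) (by norm_num)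
    fun η hη δ hδ h => by
      have := hf.norm_le_of_bound hη hδ h
      nlinarith
  exact this

/-- The right kernel `{a | f (a a⋆) = 0}` of a positive functional. -/
noncomputable def PositiveLinearMap.rightKernel (f : A →ₚ[ℂ] ℂ) : Submodule ℂ A where
  carrier := {a | f.toGNS (star a) = 0}
  add_mem' {a b} ha hb := by
    rw [Set.mem_ofPred_eq] at *
    rw [star_add, map_add, ha, hb, add_zero]
  zero_mem' := by simp
  smul_mem' c a ha := by
    rw [Set.mem_ofPred_eq] at *
    rw [star_smul, map_smul, ha, smul_zero]

theorem PositiveLinearMap.mem_rightKernel (f : A →ₚ[ℂ] ℂ) {a : A} :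
    a ∈ f.rightKernel ↔ f.toGNS (star a) = 0 := Iff.rfl

theorem IsPureState.isModularRightIdeal_rightKernel {f : A →ₚ[ℂ] ℂ} (hf : IsPureState f) :
    IsModularRightIdeal f.rightKernel := by
  obtain ⟨ξ, -, hξ⟩ := f.exists_gns_cyclic
  obtain ⟨v, hv⟩ := hf.surjective_toGNS ξ
  refine ⟨fun a ha b => ?_, star v, fun a => ?_⟩
  · rw [f.mem_rightKernel] at *
    rw [star_mul, ← f.gns_apply_toGNS, ha, map_zero]
  · rw [f.mem_rightKernel, star_sub, star_mul, star_star, map_sub, ← f.gns_apply_toGNS, hv, hξ,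
      sub_self]

theorem IsPureState.rightKernel_ne_top {f : A →ₚ[ℂ] ℂ} (hf : IsPureState f) :
    f.rightKernel ≠ ⊤ := by
  intro h
  have h0 : ∀ a, f a = 0 := fun a => by
    obtain ⟨ξ, hξ, -⟩ := f.exists_gns_cyclic
    have : star a ∈ f.rightKernel := h ▸ Submodule.mem_top
    rw [f.mem_rightKernel, star_star] at this
    rw [← hξ, this, inner_zero_right]
  have h1 := hf.1
  rw [IsState, (ContinuousLinearMap.ext h0 : (⟨f.toLinearMap, map_continuous f⟩ : A →L[ℂ] ℂ) = 0),
    norm_zero] at h1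
  exact zero_ne_one h1

theorem IsPureState.apply_mul_star_ne_zero {x : A}
    (hx : ∀ I : Submodule ℂ A, IsMaximalModularRightIdeal I → x ∉ I) {f : A →ₚ[ℂ] ℂ}
    (hf : IsPureState f) : f (x * star x) ≠ 0 := by
  intro h0
  obtain ⟨M, hM, hle⟩ := hf.isModularRightIdeal_rightKernel.exists_le_maximal hf.rightKernel_ne_top
  refine hx M hM (hle (f.mem_rightKernel.2 ?_))
  have := f.norm_toGNS_sq (star x)
  rw [star_star, h0, Complex.zero_re] at this
  exact norm_eq_zero.1 (pow_eq_zero_iff two_ne_zero |>.1 this)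

end ModularIdeals

/-! ### An approximate identity from a strictly positive element. -/

section ApproximateIdentity

variable {A : Type*} [NonUnitalCStarAlgebra A]

/-- The compression `b ↦ (1 - u) b (1 - u)`. -/
def oneSubCompress (u : A) : A →ₗ[ℂ] A where
  toFun b := b - u * b - b * u + u * b * u
  map_add' a b := by simp only [mul_add, add_mul]; abel
  map_smul' c a := by
    simp only [mul_smul_comm, smul_mul_assoc, smul_sub, smul_add, RingHom.id_apply]

theorem oneSubCompress_apply (u b : A) : oneSubCompress u b = b - u * b - b * u + u * b * u := rfl

theorem oneSubCompress_star_mul_self {u : A} (hu : IsSelfAdjoint u) (c : A) :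
    oneSubCompress u (star c * c) = star (c - c * u) * (c - c * u) := by
  rw [oneSubCompress_apply, star_sub, star_mul, hu.star_eq, sub_mul, mul_sub, mul_sub]
  simp only [mul_assoc]
  abel

theorem norm_oneSubCompress_le {u : A} (hu : ‖u‖ ≤ 1) (b : A) :
    ‖oneSubCompress u b‖ ≤ 4 * ‖b‖ := by
  have h1 : ‖u * b‖ ≤ ‖b‖ := (norm_mul_le _ _).trans (mul_le_of_le_one_left (norm_nonneg _) hu)
  have h2 : ‖b * u‖ ≤ ‖b‖ := (norm_mul_le _ _).trans (mul_le_of_le_one_right (norm_nonneg _) hu)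
  have h3 : ‖u * b * u‖ ≤ ‖b‖ :=
    (norm_mul_le _ _).trans ((mul_le_of_le_one_right (norm_nonneg _) hu).trans h1)
  rw [oneSubCompress_apply]
  have h4 := norm_add_le (b - u * b - b * u) (u * b * u)
  have h5 := norm_sub_le (b - u * b) (b * u)
  have h6 := norm_sub_le b (u * b)
  linarith

/-- The element `h² (h² + δ²)⁻¹`. -/
noncomputable def regularizedUnit (h : A) (δ : ℝ) : A :=
  cfcₙ (fun t : ℝ => t * (t / (t ^ 2 + δ ^ 2))) h

theorem regularizedUnit_eq_mul {h : A} (hh : IsSelfAdjoint h) {δ : ℝ} (hδ : 0 < δ) :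
    regularizedUnit h δ = h * cfcₙ (fun t : ℝ => t / (t ^ 2 + δ ^ 2)) h := by
  have hc : Continuous fun t : ℝ => t / (t ^ 2 + δ ^ 2) :=
    Continuous.div (by fun_prop) (by fun_prop) fun t => by positivity
  rw [regularizedUnit, cfcₙ_mul (fun t => t) _ h continuousOn_id rfl hc.continuousOn (by simp),
    cfcₙ_id' ℝ h]

theorem isSelfAdjoint_regularizedUnit (h : A) (δ : ℝ) : IsSelfAdjoint (regularizedUnit h δ) :=
  cfcₙ_predicate _ _

theorem norm_regularizedUnit_le (h : A) {δ : ℝ} (hδ : 0 < δ) : ‖regularizedUnit h δ‖ ≤ 1 := by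
  refine norm_cfcₙ_le fun t _ => ?_
  rw [← mul_div_assoc, Real.norm_of_nonneg (div_nonneg (mul_self_nonneg t) (by positivity)),
    div_le_one (by positivity)]
  nlinarith

theorem norm_oneSubCompress_regularizedUnit_le {h : A} (hh : IsSelfAdjoint h) {δ : ℝ}
    (hδ : 0 < δ) : ‖oneSubCompress (regularizedUnit h δ) h‖ ≤ δ := by
  set k : ℝ → ℝ := fun t => t * (t / (t ^ 2 + δ ^ 2)) with hk
  have hc : Continuous k :=
    continuous_id.mul (Continuous.div (by fun_prop) (by fun_prop) fun t => by positivity)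
  have hk0 : k 0 = 0 := by simp [hk]
  have hkh : regularizedUnit h δ * h = cfcₙ (fun t => k t * t) h := by
    rw [cfcₙ_mul k (fun t => t) h hc.continuousOn hk0 continuousOn_id rfl, cfcₙ_id' ℝ h]
    rfl
  have hhk : h * regularizedUnit h δ = cfcₙ (fun t => t * k t) h := by
    rw [cfcₙ_mul (fun t => t) k h continuousOn_id rfl hc.continuousOn hk0, cfcₙ_id' ℝ h]
    rfl
  have hkhk : regularizedUnit h δ * h * regularizedUnit h δ = cfcₙ (fun t => k t * t * k t) h := by
    rw [cfcₙ_mul (fun t => k t * t) k h (by fun_prop) (by simp) hc.continuousOn hk0, hkh]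
    rfl
  have hall : oneSubCompress (regularizedUnit h δ) h
      = cfcₙ (fun t => t - k t * t - t * k t + k t * t * k t) h := by
    rw [oneSubCompress_apply, hkhk, hhk, hkh,
      cfcₙ_add (fun t => t - k t * t - t * k t) (fun t => k t * t * k t) h
        (by fun_prop) (by simp) (by fun_prop) (by simp),
      cfcₙ_sub (fun t => t - k t * t) (fun t => t * k t) h
        (by fun_prop) (by simp) (by fun_prop) (by simp),
      cfcₙ_sub (fun t => t) (fun t => k t * t) h
        (by fun_prop) (by simp) (by fun_prop) (by simp), cfcₙ_id' ℝ h]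
  rw [hall]
  refine norm_cfcₙ_le fun t _ => ?_
  have hpos : 0 < t ^ 2 + δ ^ 2 := by positivity
  -- This is `(1 - k t)² t` with `1 - k t = δ² / (t² + δ²)`; it is at most `δ` in absolute value
  -- because `|t| δ` and `δ²` are both at most `t² + δ²`.
  have h1 : t - k t * t - t * k t + k t * t * k t = t * δ ^ 4 / (t ^ 2 + δ ^ 2) ^ 2 := by
    simp only [hk]
    field_simp
    ring
  rw [h1, norm_div, norm_mul, Real.norm_eq_abs, Real.norm_of_nonneg (by positivity : 0 ≤ δ ^ 4),
    Real.norm_of_nonneg (by positivity : 0 ≤ (t ^ 2 + δ ^ 2) ^ 2), div_le_iff₀ (by positivity)]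
  rw [← sq_abs t]
  have h2 : |t| * δ ≤ |t| ^ 2 + δ ^ 2 := by nlinarith [sq_nonneg (|t| - δ), sq_nonneg |t|, sq_nonneg δ]
  have h3 : δ ^ 2 ≤ |t| ^ 2 + δ ^ 2 := by nlinarith [sq_nonneg |t|]
  have h4 := mul_le_mul h2 h3 (by positivity) (by positivity)
  nlinarith [mul_le_mul_of_nonneg_left h4 hδ.le]

variable [PartialOrder A] [StarOrderedRing A]

theorem oneSubCompress_nonneg {u : A} (hu : IsSelfAdjoint u) {b : A} (hb : 0 ≤ b) :
    0 ≤ oneSubCompress u b := by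
  obtain ⟨c, rfl⟩ := CStarAlgebra.nonneg_iff_eq_star_mul_self.1 hb
  rw [oneSubCompress_star_mul_self hu]
  exact star_mul_self_nonneg _

/-- If no nonzero positive functional vanishes at `h`, then every positive element lies, up to a
small error, below a multiple of `h`. -/
theorem exists_nonneg_norm_add_sub_smul_lt {h : A}
    (hh : ∀ ψ : A →ₚ[ℂ] ℂ, ψ h = 0 → ∀ a, ψ a = 0) (hsa : IsSelfAdjoint h) {a : A} (ha : 0 ≤ a)
    {ε : ℝ} (hε : 0 < ε) : ∃ (s : ℝ) (p : A), 0 ≤ p ∧ ‖a + p - s • h‖ < ε := by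
  -- `K` is the positive cone plus the line `ℝ h`. A functional separating `-a` from its closure is
  -- nonnegative on `K`, hence zero at `h`, and gives a positive `ψ` with `ψ h = 0` but `ψ a ≠ 0`.
  let K : Set A := {b | ∃ s : ℝ, 0 ≤ b + s • h}
  have hKconv : Convex ℝ K := by
    rintro b ⟨s, hs⟩ c ⟨t, ht⟩ v w hv hw -
    refine ⟨v * s + w * t, ?_⟩
    have : v • b + w • c + (v * s + w * t) • h = v • (b + s • h) + w • (c + t • h) := by module
    rw [this]
    exact add_nonneg (smul_nonneg hv hs) (smul_nonneg hw ht)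
  have hKsmul : ∀ b ∈ K, ∀ r : ℝ, 0 ≤ r → r • b ∈ K := by
    rintro b ⟨s, hs⟩ r hr
    refine ⟨r * s, ?_⟩
    rw [mul_smul, ← smul_add]
    exact smul_nonneg hr hs
  by_cases hmem : -a ∈ closure K
  · obtain ⟨b, ⟨s, hs⟩, hb⟩ := Metric.mem_closure_iff.1 hmem ε hε
    refine ⟨s, b + s • h, hs, ?_⟩
    rw [dist_eq_norm, ← norm_neg] at hb
    have : a + (b + s • h) - s • h = -(-a - b) := by abel
    rwa [this]
  exfalso
  obtain ⟨F, u, hFa, hFK⟩ := RCLike.geometric_hahn_banach_point_closed (𝕜 := ℂ)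
    hKconv.closure isClosed_closure hmem
  simp only [RCLike.re_to_complex] at hFa hFK
  have hFK' : ∀ b ∈ K, 0 ≤ (F b).re := fun b hb => by
    by_contra! hneg
    have := hFK _ (subset_closure (hKsmul b hb (|u| / -(F b).re)
      (div_nonneg (abs_nonneg _) (by linarith))))
    rw [← Complex.coe_smul, map_smul, smul_eq_mul, Complex.re_ofReal_mul, div_mul_eq_mul_div,
      div_neg, mul_div_cancel_right₀ _ hneg.ne] at this
    linarith [neg_abs_le u]
  have hu : u < 0 := by simpa using hFK 0 (subset_closure ⟨0, by simp⟩)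
  obtain ⟨ψ, hψ⟩ := exists_positiveLinearMap_eq_re F fun b hb => hFK' b ⟨0, by simpa using hb⟩
  have h1 := hFK' (-h) ⟨1, by simp⟩
  have h2 := hFK' h ⟨-1, by simp⟩
  have h3 := hh ψ (by
    rw [hψ h hsa]
    rw [map_neg, Complex.neg_re] at h1
    exact_mod_cast le_antisymm (by linarith) h2) a
  rw [hψ a (.of_nonneg ha)] at h3
  have h4 : (F a).re = 0 := by exact_mod_cast h3
  rw [map_neg, Complex.neg_re, h4] at hFa
  linarith

/-- If no nonzero positive functional vanishes at `h`, the elements `h² (h² + δ²)⁻¹` form an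
approximate unit. -/
theorem tendsto_mul_regularizedUnit {h : A} (hh : ∀ ψ : A →ₚ[ℂ] ℂ, ψ h = 0 → ∀ a, ψ a = 0)
    (hsa : IsSelfAdjoint h) {ι : Type*} {l : Filter ι} {δ : ι → ℝ} (hδ : ∀ i, 0 < δ i)
    (hlim : Tendsto δ l (𝓝 0)) (b : A) :
    Tendsto (fun i => b * regularizedUnit h (δ i)) l (𝓝 b) := by
  rw [tendsto_iff_norm_sub_tendsto_zero, Metric.tendsto_nhds]
  intro ε hε
  -- Compression costs a factor `4`, so the error `ε ^ 2 / 8` contributes at most `ε ^ 2 / 2`; the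
  -- term in `h` contributes less than the other half.
  obtain ⟨s, p, hp, hsp⟩ := exists_nonneg_norm_add_sub_smul_lt hh hsa (star_mul_self_nonneg b)
    (show 0 < ε ^ 2 / 8 by positivity)
  have hlim' : Tendsto (fun i => |s| * δ i) l (𝓝 0) := by simpa using hlim.const_mul |s|
  filter_upwards [hlim'.eventually (gt_mem_nhds (show 0 < ε ^ 2 / 2 by positivity))] with i hi
  rw [dist_zero_right, norm_norm, norm_sub_rev]
  set w := regularizedUnit h (δ i) with hw
  have hwsa : IsSelfAdjoint w := isSelfAdjoint_regularizedUnit h (δ i)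
  have h1 : ‖b - b * w‖ ^ 2 = ‖oneSubCompress w (star b * b)‖ := by
    rw [oneSubCompress_star_mul_self hwsa, CStarRing.norm_star_mul_self, sq]
  have h2 : ‖oneSubCompress w (star b * b)‖ ≤ ‖oneSubCompress w (star b * b + p)‖ :=
    CStarAlgebra.norm_le_norm_of_nonneg_of_le
      (oneSubCompress_nonneg hwsa (star_mul_self_nonneg b)) (by
        rw [map_add]; exact le_add_of_nonneg_right (oneSubCompress_nonneg hwsa hp))
  have h3 : oneSubCompress w (star b * b + p)
      = oneSubCompress w (star b * b + p - s • h) + s • oneSubCompress w h := by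
    rw [← Complex.coe_smul s h, ← Complex.coe_smul s, map_sub, map_smul, sub_add_cancel]
  have h4 : ‖s • oneSubCompress w h‖ ≤ |s| * δ i := by
    rw [norm_smul, Real.norm_eq_abs]
    gcongr
    exact norm_oneSubCompress_regularizedUnit_le hsa (hδ i)
  have h5 := norm_oneSubCompress_le (norm_regularizedUnit_le h (hδ i))
    (star b * b + p - s • h)
  have h6 := norm_add_le (oneSubCompress w (star b * b + p - s • h)) (s • oneSubCompress w h)
  rw [← h3] at h6
  refine lt_of_pow_lt_pow_left₀ 2 hε.le ?_
  rw [h1]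
  linarith

end ApproximateIdentity

theorem isApproxRightInvertible_of_forall_positive {A : Type u} [NonUnitalCStarAlgebra A]
    [PartialOrder A] [StarOrderedRing A] {x : A}
    (hx : ∀ ψ : A →ₚ[ℂ] ℂ, ψ (x * star x) = 0 → ∀ a, ψ a = 0) : IsApproxRightInvertible x := by
  have hsa : IsSelfAdjoint (x * star x) := .mul_star_self x
  let δ : ULift.{u} ℕ → ℝ := fun j => 1 / ((j.down : ℝ) + 1)
  have hδ : ∀ j, 0 < δ j := fun j => by positivity
  have hlim : Tendsto δ atTop (𝓝 0) :=
    tendsto_one_div_add_atTop_nhds_zero_nat.comp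
      (tendsto_atTop.2 fun n => (eventually_ge_atTop (ULift.up n)).mono fun _ hj => hj)
  have hright := tendsto_mul_regularizedUnit hx hsa hδ hlim
  refine ⟨ULift.{u} ℕ, inferInstance, inferInstance, inferInstance,
    fun j => star x * cfcₙ (fun t : ℝ => t / (t ^ 2 + δ j ^ 2)) (x * star x), fun a => ?_⟩
  simp only [← mul_assoc x, ← regularizedUnit_eq_mul hsa (hδ _)]
  refine ⟨?_, hright a⟩
  -- The regularized units are self-adjoint, so taking adjoints turns right convergence into left
  -- convergence.
  have := (hright (star a)).star
  simpa only [star_mul, star_star, (isSelfAdjoint_regularizedUnit _ _).star_eq] using this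

/-! ### Pure states as extreme points. -/

section ExtremePoints

variable {A : Type*} [NonUnitalCStarAlgebra A]

noncomputable instance WeakDual.instModuleReal : Module ℝ (WeakDual ℂ A) := WeakDual.instModule' ℝ

instance WeakDual.locallyConvexSpace_real : LocallyConvexSpace ℝ (WeakDual ℂ A) :=
  WeakBilin.locallyConvexSpace

theorem WeakDual.real_smul_apply (r : ℝ) (ψ : WeakDual ℂ A) (a : A) :
    (r • ψ) a = (r : ℂ) * ψ a := by
  rw [← smul_eq_mul, Complex.coe_smul]
  rfl

variable [PartialOrder A] [StarOrderedRing A]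

namespace PositiveLinearMap

/-- A positive functional as a continuous functional. -/
noncomputable def toCLM (f : A →ₚ[ℂ] ℂ) : A →L[ℂ] ℂ := ⟨f.toLinearMap, map_continuous f⟩

@[simp]
theorem toCLM_apply (f : A →ₚ[ℂ] ℂ) (a : A) : f.toCLM a = f a := rfl

/-- The norm of a positive functional is attained along the approximate unit. -/
theorem tendsto_norm_toCLM (f : A →ₚ[ℂ] ℂ) :
    Tendsto (fun e => (f (star e * e)).re) (CStarAlgebra.approximateUnit A) (𝓝 ‖f.toCLM‖) := by
  have hl := CStarAlgebra.increasingApproximateUnit A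
  refine tendsto_order.2 ⟨fun K hK => ?_, fun K hK => ?_⟩
  · by_cases hK0 : K < 0
    · exact Eventually.of_forall fun e => hK0.trans_le (f.apply_re_nonneg (star_mul_self_nonneg e))
    push Not at hK0
    have hN : 0 < ‖f.toCLM‖ := hK0.trans_lt hK
    -- The threshold is chosen so that Cauchy–Schwarz, `|f (e * a)|² ≤ f (star e * e) * ‖f‖ * ‖a‖²`,
    -- forces `f (star e * e) > K`.
    obtain ⟨a, ha⟩ : ∃ a, √(K * ‖f.toCLM‖) * ‖a‖ < ‖f a‖ := by
      by_contra! h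
      have h1 := f.toCLM.opNorm_le_bound (Real.sqrt_nonneg _) h
      have h2 : √(K * ‖f.toCLM‖) < ‖f.toCLM‖ := by
        rw [Real.sqrt_lt' hN]
        nlinarith
      linarith
    have ha0 : 0 < ‖a‖ := norm_pos_iff.2 (by rintro rfl; simp at ha)
    have hlim : Tendsto (fun e => ‖f (e * a)‖) (CStarAlgebra.approximateUnit A) (𝓝 ‖f a‖) :=
      (((map_continuous f).tendsto a).comp (hl.tendsto_mul_right a)).norm
    filter_upwards [hlim.eventually (lt_mem_nhds ha), hl.eventually_star_eq] with e he hse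
    have h1 : ‖f (e * a)‖ ≤ ‖f.toGNS e‖ * ‖f.toGNS a‖ := by
      have := norm_inner_le_norm (𝕜 := ℂ) (f.toGNS e) (f.toGNS a)
      rwa [inner_toGNS, hse] at this
    have h2 := f.norm_toGNS_le (fun a _ => f.re_apply_le a) a
    have h3 : √(K * ‖f.toCLM‖) * ‖a‖ < ‖f.toGNS e‖ * (√‖f.toCLM‖ * ‖a‖) :=
      he.trans_le (h1.trans (mul_le_mul_of_nonneg_left h2 (norm_nonneg _)))
    rw [Real.sqrt_mul hK0, ← mul_assoc] at h3
    have h4 := lt_of_mul_lt_mul_right (lt_of_mul_lt_mul_right h3 ha0.le) (Real.sqrt_nonneg _)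
    rw [← norm_toGNS_sq]
    exact (Real.sqrt_lt' ((Real.sqrt_nonneg _).trans_lt h4)).1 h4
  · filter_upwards [hl.eventually_norm] with e he
    refine lt_of_le_of_lt (f.re_apply_le _) (lt_of_le_of_lt ?_ hK)
    refine mul_le_of_le_one_right (norm_nonneg _) ?_
    rw [CStarRing.norm_star_mul_self]
    exact mul_le_one₀ he (norm_nonneg _) he

/-- The norm is the limit of `f (star e * e)`, which is additive in `f`. Additivity supplies the
convex weights in the purity argument. -/
theorem norm_toCLM_eq_add {f g p : A →ₚ[ℂ] ℂ} (h : ∀ a, p a = f a + g a) :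
    ‖p.toCLM‖ = ‖f.toCLM‖ + ‖g.toCLM‖ := by
  have := (CStarAlgebra.increasingApproximateUnit A).neBot
  refine tendsto_nhds_unique p.tendsto_norm_toCLM ?_
  simp only [h, Complex.add_re]
  exact f.tendsto_norm_toCLM.add g.tendsto_norm_toCLM

theorem eq_zero_of_norm_toCLM {f : A →ₚ[ℂ] ℂ} (h : ‖f.toCLM‖ = 0) (a : A) : f a = 0 := by
  rw [← f.toCLM_apply, norm_eq_zero.1 h]; rfl

end PositiveLinearMap

/-- The positive functionals of norm at most one that vanish at `h`. -/
def vanishingQuasiStates (h : A) : Set (WeakDual ℂ A) :=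
  {ψ | (∀ a : A, 0 ≤ a → 0 ≤ ψ a) ∧ ψ h = 0 ∧ ‖WeakDual.toStrongDual ψ‖ ≤ 1}

omit [StarOrderedRing A] in
theorem isCompact_vanishingQuasiStates (h : A) : IsCompact (vanishingQuasiStates h) := by
  refine (WeakDual.isCompact_closedBall (𝕜 := ℂ) (E := A) 0 1).of_isClosed_subset ?_
    fun ψ hψ => by simpa using hψ.2.2
  have h1 : IsClosed {ψ : WeakDual ℂ A | ∀ a : A, 0 ≤ a → 0 ≤ ψ a} := by
    simp only [Set.ofPred_forall]
    exact isClosed_iInter fun a => isClosed_iInter fun _ =>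
      isClosed_Ici.preimage (WeakDual.eval_continuous a)
  have h2 : IsClosed {ψ : WeakDual ℂ A | ψ h = 0} :=
    isClosed_singleton.preimage (WeakDual.eval_continuous h)
  have h3 : IsClosed {ψ : WeakDual ℂ A | ‖WeakDual.toStrongDual ψ‖ ≤ 1} := by
    have := WeakDual.isClosed_closedBall (𝕜 := ℂ) (E := A) 0 1
    convert this using 1
    ext ψ
    simp
  exact h1.inter (h2.inter h3)

omit [StarOrderedRing A] in
theorem convex_vanishingQuasiStates (h : A) : Convex ℝ (vanishingQuasiStates h) := by
  rintro ψ ⟨h1, h2, h3⟩ φ ⟨g1, g2, g3⟩ s t hs ht hst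
  refine ⟨fun a ha => ?_, ?_, ?_⟩
  · change 0 ≤ (s • ψ) a + (t • φ) a
    rw [WeakDual.real_smul_apply, WeakDual.real_smul_apply]
    exact add_nonneg (mul_nonneg (by exact_mod_cast hs) (h1 a ha))
      (mul_nonneg (by exact_mod_cast ht) (g1 a ha))
  · change (s • ψ) h + (t • φ) h = 0
    rw [WeakDual.real_smul_apply, WeakDual.real_smul_apply, h2, g2]
    simp
  · have := (convex_closedBall (0 : StrongDual ℂ A) 1) (x := WeakDual.toStrongDual ψ)
      (by simpa using h3) (y := WeakDual.toStrongDual φ) (by simpa using g3) hs ht hst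
    rw [mem_closedBall_zero_iff] at this
    exact this

namespace PositiveLinearMap

/-- The functional `r • f` as an element of the weak dual. -/
noncomputable def toWeakDual (r : ℝ) (f : A →ₚ[ℂ] ℂ) : WeakDual ℂ A :=
  StrongDual.toWeakDual ((r : ℂ) • f.toCLM)

theorem toWeakDual_apply (r : ℝ) (f : A →ₚ[ℂ] ℂ) (a : A) : toWeakDual r f a = r * f a := rfl

theorem toWeakDual_mem {f : A →ₚ[ℂ] ℂ} {h : A} (hf : f h = 0) {r : ℝ} (hr : 0 ≤ r)
    (hrf : r * ‖f.toCLM‖ ≤ 1) : toWeakDual r f ∈ vanishingQuasiStates h := by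
  refine ⟨fun a ha => ?_, ?_, ?_⟩
  · rw [toWeakDual_apply]
    exact mul_nonneg (by exact_mod_cast hr) (f.map_nonneg ha)
  · rw [toWeakDual_apply, hf, mul_zero]
  · change ‖(r : ℂ) • f.toCLM‖ ≤ 1
    rwa [norm_smul, Complex.norm_real, Real.norm_of_nonneg hr]

end PositiveLinearMap

open PositiveLinearMap

/-- A nonzero extreme point of the quasi-states vanishing at a positive element is a pure state. -/
theorem isPureState_of_mem_extremePoints {h : A} (hh : 0 ≤ h) {τ : A →ₚ[ℂ] ℂ}
    (hτ : toWeakDual 1 τ ∈ (vanishingQuasiStates h).extremePoints ℝ) (h0 : ∃ a, τ a ≠ 0) :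
    IsPureState τ := by
  obtain ⟨hmem, hext⟩ := hτ
  have hτh : τ h = 0 := by simpa [toWeakDual_apply] using hmem.2.1
  have hle : ‖τ.toCLM‖ ≤ 1 := by
    have : ‖((1 : ℝ) : ℂ) • τ.toCLM‖ ≤ 1 := hmem.2.2
    simpa using this
  obtain ⟨a₀, ha₀⟩ := h0
  have hpos : 0 < ‖τ.toCLM‖ := norm_pos_iff.2 fun h => ha₀ (by
    rw [← τ.toCLM_apply, h]; rfl)
  -- A decomposition `τ = ρ + σ` into nonzero parts is proportional, by extremality.
  have hsplit : ∀ ρ σ : A →ₚ[ℂ] ℂ, ρ h = 0 → σ h = 0 → ∀ s t : ℝ, 0 < s → 0 < t → s + t = 1 →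
      ‖ρ.toCLM‖ ≤ s → ‖σ.toCLM‖ ≤ t → (∀ a, τ a = ρ a + σ a) → ∀ a, ρ a = s * τ a := by
    intro ρ σ hρ hσ s t hs ht hst hρs hσt hsum a
    have h1 := hext (toWeakDual_mem hρ (inv_nonneg.2 hs.le) (by rwa [inv_mul_le_one₀ hs]))
      (toWeakDual_mem hσ (inv_nonneg.2 ht.le) (by rwa [inv_mul_le_one₀ ht]))
      ⟨s, t, hs, ht, hst, ?_⟩
    · have h2 := congrArg (fun ψ : WeakDual ℂ A => ψ a) h1
      simp only [toWeakDual_apply, Complex.ofReal_one, one_mul] at h2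
      rw [← h2, Complex.ofReal_inv, mul_inv_cancel_left₀ (by exact_mod_cast hs.ne')]
    · refine DFunLike.ext _ _ fun b => ?_
      change (s • toWeakDual s⁻¹ ρ) b + (t • toWeakDual t⁻¹ σ) b = _
      rw [WeakDual.real_smul_apply, WeakDual.real_smul_apply, toWeakDual_apply, toWeakDual_apply,
        toWeakDual_apply, hsum, Complex.ofReal_inv, Complex.ofReal_inv,
        mul_inv_cancel_left₀ (by exact_mod_cast hs.ne'),
        mul_inv_cancel_left₀ (by exact_mod_cast ht.ne'), Complex.ofReal_one, one_mul]
  have hnorm : ‖τ.toCLM‖ = 1 := by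
    by_contra hne
    have hlt := lt_of_le_of_ne hle hne
    -- If `‖τ‖ < 1`, then `τ` lies strictly between `0` and `τ / ‖τ‖`, and extremality gives `τ =
    -- ‖τ‖ τ`.
    have h1 := hsplit τ 0 hτh rfl ‖τ.toCLM‖ (1 - ‖τ.toCLM‖) hpos (by linarith) (by ring) le_rfl
      (by
        have : (0 : A →ₚ[ℂ] ℂ).toCLM = 0 := rfl
        rw [this, norm_zero]
        linarith) (fun a => (add_zero _).symm) a₀
    have h2 : ((‖τ.toCLM‖ : ℝ) : ℂ) = 1 := mul_right_cancel₀ ha₀ (by rw [← h1, one_mul])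
    exact hne (by exact_mod_cast h2)
  refine ⟨hnorm, fun ρ hρ => ?_⟩
  let σ : A →ₚ[ℂ] ℂ := PositiveLinearMap.mk₀ (τ.toLinearMap - ρ.toLinearMap) fun a ha =>
    sub_nonneg.2 (hρ a ha)
  have hσ : ∀ a, σ a = τ a - ρ a := fun a => rfl
  have hsum : ∀ a, τ a = ρ a + σ a := fun a => by rw [hσ]; ring
  have hadd := norm_toCLM_eq_add hsum
  rw [hnorm] at hadd
  -- Positivity of `h` makes the vanishing condition hereditary: both summands of `τ` stay in the
  -- set.
  have hρh : ρ h = 0 := le_antisymm ((hρ h hh).trans hτh.le) (ρ.map_nonneg hh)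
  have hσh : σ h = 0 := by rw [hσ, hτh, hρh, sub_zero]
  rcases (norm_nonneg ρ.toCLM).eq_or_lt with hr | hr
  · exact ⟨0, by simp, fun a => by simp [eq_zero_of_norm_toCLM hr.symm a]⟩
  rcases (norm_nonneg σ.toCLM).eq_or_lt with hs | hs
  · exact ⟨1, by simp, fun a => by simp [hsum a, eq_zero_of_norm_toCLM hs.symm a]⟩
  exact ⟨‖ρ.toCLM‖, ⟨hr.le, by linarith⟩,
    hsplit ρ σ hρh hσh _ _ hr hs hadd.symm le_rfl le_rfl hsum⟩

/-- If a nonzero positive functional vanishes at a positive element, so does some pure state. -/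
theorem exists_isPureState_apply_eq_zero {h : A} (hh : 0 ≤ h) {ψ : A →ₚ[ℂ] ℂ} (hψ : ψ h = 0)
    (h0 : ∃ a, ψ a ≠ 0) : ∃ τ : A →ₚ[ℂ] ℂ, IsPureState τ ∧ τ h = 0 := by
  obtain ⟨a₀, ha₀⟩ := h0
  have hpos : 0 < ‖ψ.toCLM‖ := norm_pos_iff.2 fun h => ha₀ (by
    rw [← ψ.toCLM_apply, h]; rfl)
  have hmem : toWeakDual ‖ψ.toCLM‖⁻¹ ψ ∈ vanishingQuasiStates h :=
    toWeakDual_mem hψ (by positivity) (by rw [inv_mul_cancel₀ hpos.ne'])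
  -- If `0` were the only extreme point, Krein–Milman would reduce the whole set to `{0}`.
  obtain ⟨φ, hφ, hφ0⟩ : ∃ φ ∈ (vanishingQuasiStates h).extremePoints ℝ, φ ≠ 0 := by
    by_contra! hall
    rw [← closure_convexHull_extremePoints (isCompact_vanishingQuasiStates h)
      (convex_vanishingQuasiStates h)] at hmem
    have h1 : closure (convexHull ℝ ((vanishingQuasiStates h).extremePoints ℝ)) ⊆ {0} :=
      closure_minimal (convexHull_min hall (convex_singleton 0)) isClosed_singleton
    have h2 := congrArg (fun φ : WeakDual ℂ A => φ a₀) (h1 hmem)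
    simp only [toWeakDual_apply] at h2
    refine mul_ne_zero ?_ ha₀ h2
    exact_mod_cast (inv_pos.2 hpos).ne'
  let τ : A →ₚ[ℂ] ℂ := PositiveLinearMap.mk₀ (WeakDual.toStrongDual φ).toLinearMap hφ.1.1
  have hτφ : toWeakDual 1 τ = φ := DFunLike.ext _ _ fun a => by
    rw [toWeakDual_apply, Complex.ofReal_one, one_mul]
    rfl
  refine ⟨τ, isPureState_of_mem_extremePoints hh (hτφ ▸ hφ) ?_, hφ.1.2.1⟩
  by_contra! hz
  exact hφ0 (DFunLike.ext _ _ hz)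

end ExtremePoints

theorem mainTheorem1 {A : Type u} [NonUnitalCStarAlgebra A] [PartialOrder A] [StarOrderedRing A]
    (hnonunital : ¬ ∃ e : A, ∀ a : A, e * a = a ∧ a * e = a)
    (hnonabelian : ∃ a b : A, a * b ≠ b * a)
    (x : A) :
    List.TFAE [
      IsApproxRightInvertible x,
      ∀ I : Submodule ℂ A, IsMaximalModularRightIdeal I → x ∉ I,
      ∀ τ : A →ₚ[ℂ] ℂ, IsPureState τ → τ (x * star x) ≠ 0] := by
  tfae_have 1 → 2 := fun h I hI => h.notMem_of_isModularRightIdeal hI.prop.1 hI.prop.2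
  tfae_have 2 → 3 := fun h τ hτ => hτ.apply_mul_star_ne_zero h
  tfae_have 3 → 1 := fun h => isApproxRightInvertible_of_forall_positive fun ψ hψ => by
    by_contra! h0
    obtain ⟨τ, hτ, hτ0⟩ := exists_isPureState_apply_eq_zero (mul_star_self_nonneg x) hψ h0
    exact h τ hτ hτ0
  tfae_finish
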